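/- Conventions. For an integer $k\ge 1$ put $\log(k)=\lfloor\log_2 k\rfloor+1$ (the number of binary digits of $k$), and let $\log^*(n)$ be the number of times the binary logarithm $\log_2$ must be applied to $n$ until the result is at most $1$. Models. For $\ell\ge 1$ let $\Pi_\ell=\{p_1,\dots,p_\ell\}$. In a Kripke model over $\Pi_\ell$ (with non-empty domain) the identifier of a node $w$ is the $\ell$-bit string whose $i$th bit is $1$ iff $p_i$ holds at $w$. Let $\mathcal G(\ell,\Delta)$ be the class of finite Kripke models $(W,R,V)$ over $\Pi_\ell$ in which distinct nodes have distinct identifiers, every node has out-degree at most $\Delta$, and $R$ is symmetric and irreflexive. (In particular, for $\ell=\log(n)$ it contains every $n$-node graph of maximum degree at most $\Delta$ whose nodes carry the identifiers $1,\dots,n$ in binary.) The $i$th neighbour of $w$ is the $i$th element of $\{v : (w,v)\in R\}$ in the lexicographic order of the identifiers. Programs. A $(\Pi_\ell,\Delta)$-program of MPMSC has a finite non-empty linearly ordered set of schema variables (its heads) and, for each head $Y$, a terminal clause $Y(0):=\varphi$ and an iteration clause $Y:=_{\varphi_1,\dots,\varphi_m}\psi_1;\dots;\psi_m;\chi$ ($m\ge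 0$). The formulas are built from $\top$, propositions of $\Pi_\ell$, heads (not in terminal clauses), $\neg$, $\wedge$ and $\Diamond_1,\dots,\Diamond_\Delta$, where $\Diamond_i\varphi$ says that the $i$th neighbour exists and satisfies $\varphi$; $\varphi$ and the conditions $\varphi_k$ have modal depth $0$, and the $\psi_k$ and $\chi$ have modal depth at most $1$. In round $0$ the head $Y$ has at each node the truth value of the body of its terminal clause. In round $r+1$ it has at $w$ the truth value of $\psi_k$ for the first $k$ such that $\varphi_k$ is true at $w$, or of $\chi$ if there is no such $k$; all of these are evaluated with the values of the heads in round $r$. Round $r+1$ is a global communication round if, at some node, the $\psi_k$ or $\chi$ used by some clause in that round contains a diamond. Some heads are attention predicates and some are print predicates; both kinds are called appointed. In the first round in which some attention predicate is true at $w$, the node $w$ outputs the string of truth values of the print predicates at $w$ in that round. A program defines a $k$-colouring if on every model in $\mathcal G(\ell,\Delta)$ every node outputs, in some round, a string $0^a10^b$ with $0\le a\le k-1$ and $b\ge 0$; the colouring is proper if adjacent nodes always output different strings. The size of a program is the number of occurrences of proposition symbols, heads, and operators $\top,\neg,\wedge,\Diamond_i$ in its clauses. Lemma (Cole–Vishkin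 lemma). There is an absolute constant $C$ such that for all integers $n\ge 1$ and $\Delta\ge 1$ there is a $(\Pi_{\log(n)},\Delta)$-program of MPMSC whose attention predicates and print predicates coincide, which has exactly $7^\Delta$ appointed predicates, and which has the following properties. 1. It defines a proper $7^\Delta$-colouring. 2. Ignoring the appointed predicates (and their clauses), it has at most $C\,\Delta\log(n)$ heads and size at most $C\,\Delta^2\log(n)$. 3. If $n\ge 2$, then on every model in $\mathcal G(\log(n),\Delta)$ every node outputs in a round $r\le C\log(n)\,\log(\log(n))\,\log^*(n)$. 4. On every model in $\mathcal G(\log(n),\Delta)$ the whole run has exactly $\log^*(n)+4$ global communication rounds, and every node outputs in or after the last of them. -/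

import Mathlib

namespace MPMSC

/-! ### Kripke models with identifiers -/

/-- A Kripke model over the `ℓ` identifier propositions `p_1, …, p_ℓ`
(the symbol `p_{i+1}` is `i : Fin ℓ`). -/
structure KripkeModel (ℓ : ℕ) where
  /-- the domain -/
  W : Type
  nonempty : Nonempty W
  /-- the accessibility relation -/
  R : W → W → Prop
  /-- the valuation -/
  V : Fin ℓ → Set W

namespace KripkeModel

variable {ℓ : ℕ}

/-- The set of out-neighbours of a node. -/
def succ (M : KripkeModel ℓ) (w : M.W) : Set M.W := {v | M.R w v}

open Classical in
/-- The identifier of a node: the `ℓ`-bit string whose `i`-th bit tells whether `p_i` holds.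
Identifiers are ordered lexicographically, with `false < true`. -/
noncomputable def ident (M : KripkeModel ℓ) (w : M.W) : Lex (Fin ℓ → Bool) :=
  toLex fun i => decide (w ∈ M.V i)

/-- `v` is the `(i+1)`-st neighbour of `w`: an out-neighbour of `w` such that exactly `i`
out-neighbours of `w` have a smaller identifier. -/
def IsNeighbour (M : KripkeModel ℓ) (i : ℕ) (w v : M.W) : Prop :=
  v ∈ M.succ w ∧ {u | u ∈ M.succ w ∧ M.ident u < M.ident v}.ncard = i

/-- The class of finite Kripke models with (pairwise distinct) identifiers and with out-degree
at most `Δ`. -/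
def InClass (M : KripkeModel ℓ) (Δ : ℕ) : Prop :=
  Finite M.W ∧ Function.Injective M.ident ∧ ∀ w, (M.succ w).ncard ≤ Δ

/-- The models in the class above that are graphs: the edge relation is symmetric and
irreflexive. -/
def IsGraph (M : KripkeModel ℓ) (Δ : ℕ) : Prop :=
  M.InClass Δ ∧ (∀ w v, M.R w v → M.R v w) ∧ ∀ w, ¬ M.R w w

end KripkeModel

/-! ### Schemata -/

/-- Multimodal schemata over the propositions `p_1, …, p_ℓ`, the diamonds `◇_1, …, ◇_Δ`
(`◇_{i+1}` is `dia i`) and the schema variables in `X`. -/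
inductive Schema (ℓ Δ : ℕ) (X : Type) : Type
  | top : Schema ℓ Δ X
  | prop : Fin ℓ → Schema ℓ Δ X
  | var : X → Schema ℓ Δ X
  | neg : Schema ℓ Δ X → Schema ℓ Δ X
  | and : Schema ℓ Δ X → Schema ℓ Δ X → Schema ℓ Δ X
  | dia : Fin Δ → Schema ℓ Δ X → Schema ℓ Δ X

namespace Schema

variable {ℓ Δ : ℕ} {X : Type}

/-- The maximum nesting depth of diamonds. -/
def modalDepth : Schema ℓ Δ X → ℕ
  | top => 0
  | prop _ => 0
  | var _ => 0
  | neg φ => φ.modalDepth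
  | and φ ψ => max φ.modalDepth ψ.modalDepth
  | dia _ φ => φ.modalDepth + 1

/-- The number of occurrences of proposition symbols, schema variables and operators. -/
def length : Schema ℓ Δ X → ℕ
  | top => 1
  | prop _ => 1
  | var _ => 1
  | neg φ => φ.length + 1
  | and φ ψ => φ.length + ψ.length + 1
  | dia _ φ => φ.length + 1

/-- Truth of a schema at a node, where the schema variable `Y` is true at exactly the nodes `w`
with `g Y w`. -/
def Sat (M : KripkeModel ℓ) (g : X → M.W → Prop) : Schema ℓ Δ X → M.W → Prop
  | top, _ => True
  | prop i, w => w ∈ M.V i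
  | var Y, w => g Y w
  | neg φ, w => ¬ Sat M g φ w
  | and φ ψ, w => Sat M g φ w ∧ Sat M g ψ w
  | dia i φ, w => ∃ v, M.IsNeighbour i w v ∧ Sat M g φ v

end Schema

/-! ### Iteration clauses -/

/-- The right-hand side `φ_1, …, φ_m : ψ_1; …; ψ_m; χ` of an iteration clause. The list consists
of the pairs (condition `φ_k`, consequence `ψ_k`); the backup is `χ`. A standard clause with
body `χ` has the empty list of conditions. -/
structure Clause (ℓ Δ : ℕ) (X : Type) where
  branches : List (Schema ℓ Δ X × Schema ℓ Δ X)
  backup : Schema ℓ Δ X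

namespace Clause

variable {ℓ Δ : ℕ} {X : Type}

/-- The number of symbol occurrences in the right-hand side. -/
def length (c : Clause ℓ Δ X) : ℕ :=
  (c.branches.map fun b => b.1.length + b.2.length).sum + c.backup.length

open Classical in
/-- The schema used as the body of the clause at the node `w`: the consequence of the first
condition that is true at `w`, and the backup if no condition is true at `w`. -/
noncomputable def hotBody (c : Clause ℓ Δ X) (M : KripkeModel ℓ) (g : X → M.W → Prop)
    (w : M.W) : Schema ℓ Δ X :=
  ((c.branches.find? fun b => decide (b.1.Sat M g w)).map Prod.snd).getD c.backup

end Clause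

/-! ### Programs -/

/-- A program of message passing modal substitution calculus over `p_1, …, p_ℓ` with diamonds
`◇_1, …, ◇_Δ`, whose set of head predicates is the finite linearly ordered set `H` of schema
variables. -/
structure Program (ℓ Δ : ℕ) (H : Type) where
  nonempty : Nonempty H
  /-- the body of the terminal clause of a head predicate -/
  terminal : H → Schema ℓ Δ Empty
  /-- the iteration clause of a head predicate -/
  iteration : H → Clause ℓ Δ H
  /-- the attention predicates -/
  attention : Finset H
  /-- the print predicates -/
  print : Finset H
  terminal_depth : ∀ Y, (terminal Y).modalDepth = 0
  condition_depth : ∀ Y, ∀ b ∈ (iteration Y).branches, b.1.modalDepth = 0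
  consequence_depth : ∀ Y, ∀ b ∈ (iteration Y).branches, b.2.modalDepth ≤ 1
  backup_depth : ∀ Y, (iteration Y).backup.modalDepth ≤ 1

namespace Program

variable {ℓ Δ : ℕ} {H : Type}

/-- The global configuration of round `n`: `Λ.config M n Y w` says that the `n`-th iteration
formula of the head predicate `Y` is true at `w`. -/
noncomputable def config (Λ : Program ℓ Δ H) (M : KripkeModel ℓ) : ℕ → H → M.W → Prop
  | 0, Y, w => (Λ.terminal Y).Sat M (fun x _ => x.elim) w
  | n + 1, Y, w =>
      ((Λ.iteration Y).hotBody M (Λ.config M n) w).Sat M (Λ.config M n) w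

/-- The node `w` accepts in round `n`: some attention predicate is true there in round `n`, and
none is true there in an earlier round. -/
def AcceptsAt (Λ : Program ℓ Δ H) (M : KripkeModel ℓ) (w : M.W) (n : ℕ) : Prop :=
  (∃ Y ∈ Λ.attention, Λ.config M n Y w) ∧
    ∀ m < n, ∀ Y ∈ Λ.attention, ¬ Λ.config M m Y w

open Classical in
/-- The string of truth values of the print predicates, in the order of the schema variables. -/
noncomputable def printString [LinearOrder H] (Λ : Program ℓ Δ H) (M : KripkeModel ℓ)
    (w : M.W) (n : ℕ) : List Bool :=
  (Λ.print.sort (· ≤ ·)).map fun Y => decide (Λ.config M n Y w)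

/-- The node `w` outputs the string `p` in round `n`. -/
def OutputsAt [LinearOrder H] (Λ : Program ℓ Δ H) (M : KripkeModel ℓ) (w : M.W) (n : ℕ)
    (p : List Bool) : Prop :=
  Λ.AcceptsAt M w n ∧ p = Λ.printString M w n

/-- In every graph of the class, every node outputs a string `0^a 1 0^b` with `a ≤ k - 1`. -/
def DefinesColouring [LinearOrder H] (Λ : Program ℓ Δ H) (k : ℕ) : Prop :=
  ∀ M : KripkeModel ℓ, M.IsGraph Δ → ∀ w : M.W, ∃ n p, Λ.OutputsAt M w n p ∧
    ∃ a b : ℕ, a < k ∧ p = List.replicate a false ++ true :: List.replicate b false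

/-- The program defines a `k`-colouring in which adjacent nodes output different strings. -/
def DefinesProperColouring [LinearOrder H] (Λ : Program ℓ Δ H) (k : ℕ) : Prop :=
  Λ.DefinesColouring k ∧
    ∀ M : KripkeModel ℓ, M.IsGraph Δ → ∀ w v : M.W, M.R w v →
      ∀ m n p q, Λ.OutputsAt M w m p → Λ.OutputsAt M v n q → p ≠ q

/-- The set of global communication rounds `n ≥ 1`: at some node, the consequence or backup that
some clause uses in round `n` contains a diamond. (Which one is used in round `n` is decided
by the truth values of round `n - 1`.) -/
def commRounds (Λ : Program ℓ Δ H) (M : KripkeModel ℓ) : Set ℕ :=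
  {n | ∃ m, n = m + 1 ∧ ∃ (w : M.W) (Y : H),
    0 < ((Λ.iteration Y).hotBody M (Λ.config M m) w).modalDepth}

/-- The appointed predicates. -/
def appointed [DecidableEq H] (Λ : Program ℓ Δ H) : Finset H := Λ.attention ∪ Λ.print

/-- The number of head predicates that are not appointed. -/
def numHeads [Fintype H] [DecidableEq H] (Λ : Program ℓ Δ H) : ℕ := (Λ.appointedᶜ).card

/-- The number of occurrences of symbols in the terminal and iteration clauses of the head
predicates that are not appointed (in each clause, the head itself is one occurrence). -/
def size [Fintype H] [DecidableEq H] (Λ : Program ℓ Δ H) : ℕ :=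
  ∑ Y ∈ Λ.appointedᶜ, ((1 + (Λ.terminal Y).length) + (1 + (Λ.iteration Y).length))

end Program

/-- The number of binary digits of `k ≥ 1`, that is, `⌊log₂ k⌋ + 1`. -/
def bitLog (k : ℕ) : ℕ := Nat.log 2 k + 1

/-- The iterated logarithm `log* n`: how often the binary logarithm has to be applied to `n`
until the value is at most `1`. -/
noncomputable def logStar (n : ℕ) : ℕ := sInf {k : ℕ | (Real.logb 2)^[k] (n : ℝ) ≤ 1}

end MPMSC

namespace MPMSC

/-! ### The iterated logarithm -/

/-! Fix `i` and let every node point to its `i`th neighbour, if there is one. Starting from the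
identifiers, a Cole–Vishkin step replaces a colour by the first position at which its binary digits
differ from those of the colour pointed at, together with its own digit there. If two nodes joined
by a pointer had equal new colours, the positions and the digits would agree, contradicting the
choice of the position (`cvStep_ne`, `KripkeModel.colour_ne`). A step turns `b` bits into about `log
b` bits, so about `log* n` steps leave three bits (`bitBound_le_three`), and one more step leaves
fewer than six colours. This is done for all `i` in parallel and the tuple of final colours is
output: on an edge one endpoint is the `i`th neighbour of the other for some `i`, so the tuples
differ in that coordinate.

The program spends one phase of `ℓ + 2` rounds on each step (`config_col_succ`): one round compares
digits with the neighbours, `ℓ` rounds scan the positions while a binary counter keeps the index,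
and one round overwrites the colours. Only the comparison uses diamonds, so communication rounds
correspond to phases, of which there are `log* n + 4`. All nodes output together, right after the
last phase. There are `O(Δℓ)` heads; most clauses have constant size, and the longer ones (counter
and scan) still fit into a total of `O(Δℓ)`. -/

theorem exists_iterate_logb_le_one (k : ℕ) (x : ℝ) (hx : x ≤ k + 1) :
    ∃ j ≤ k, (Real.logb 2)^[j] x ≤ 1 := by
  induction k generalizing x with
  | zero => exact ⟨0, le_rfl, by simpa using hx⟩
  | succ k ih =>
    rcases le_or_gt x 1 with h1 | h1
    · exact ⟨0, Nat.zero_le _, by simpa using h1⟩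
    · have hlog : Real.logb 2 x ≤ k + 1 := by
        rcases le_or_gt x 2 with h2 | h2
        · have : Real.logb 2 x ≤ Real.logb 2 2 :=
            Real.logb_le_logb_of_le (by norm_num) (by linarith) h2
          rw [Real.logb_self_eq_one (by norm_num)] at this
          have : (0 : ℝ) ≤ k := Nat.cast_nonneg k
          linarith
        · have hb : x ≤ (2 : ℝ) ^ (x - 1) := by
            -- Bernoulli's inequality gives `x ≤ 2 ^ (x - 1)` for `x ≥ 2`, so a logarithm lowers
            -- such an `x` by at least one.
            have := one_add_mul_self_le_rpow_one_add (s := 1) (p := x - 1) (by norm_num)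
              (by linarith)
            norm_num at this
            exact this
          have := (Real.logb_le_iff_le_rpow (by norm_num) (by linarith)).2 hb
          push_cast at hx
          linarith
      obtain ⟨j, hj, h⟩ := ih _ hlog
      exact ⟨j + 1, by omega, by simpa using h⟩

theorem logStar_spec (n : ℕ) : (Real.logb 2)^[logStar n] (n : ℝ) ≤ 1 := by
  obtain ⟨j, -, h⟩ := exists_iterate_logb_le_one n n (by linarith)
  exact Nat.sInf_mem (s := {k : ℕ | (Real.logb 2)^[k] (n : ℝ) ≤ 1}) ⟨j, h⟩

theorem one_lt_iterate_of_lt_logStar {n k : ℕ} (h : k < logStar n) :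
    1 < (Real.logb 2)^[k] (n : ℝ) :=
  not_le.1 fun hk => Nat.notMem_of_lt_sInf h hk

theorem logb_le_bitLog {n : ℕ} (hn : 1 ≤ n) : Real.logb 2 n ≤ bitLog n := by
  have h0 : (0 : ℝ) < n := by exact_mod_cast hn
  rw [Real.logb_le_iff_le_rpow (by norm_num) h0, Real.rpow_natCast]
  exact_mod_cast (Nat.lt_pow_succ_log_self (by norm_num : 1 < 2) n).le

theorem bitLog_le_logb_add_one {n : ℕ} (hn : 1 ≤ n) : (bitLog n : ℝ) ≤ Real.logb 2 n + 1 := by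
  have h0 : (0 : ℝ) < n := by exact_mod_cast hn
  have : (Nat.log 2 n : ℝ) ≤ Real.logb 2 n := by
    rw [Real.le_logb_iff_rpow_le (by norm_num) h0, Real.rpow_natCast]
    exact_mod_cast Nat.pow_log_le_self 2 (by omega)
  unfold bitLog
  push_cast
  linarith

/-- A crude bound suffices: it lets the clock have one head per phase within the linear size budget.
-/
theorem logStar_le_bitLog {n : ℕ} (hn : 1 ≤ n) : logStar n ≤ bitLog n + 1 := by
  obtain ⟨j, hj, h⟩ := exists_iterate_logb_le_one (bitLog n) (Real.logb 2 n)
    (by linarith [logb_le_bitLog hn])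
  have : logStar n ≤ j + 1 := Nat.sInf_le (by simpa using h)
  omega

theorem one_le_logStar {n : ℕ} (hn : 2 ≤ n) : 1 ≤ logStar n := by
  by_contra h
  have h0 : logStar n = 0 := by omega
  have := logStar_spec n
  rw [h0] at this
  have h2 : (2 : ℝ) ≤ n := by exact_mod_cast hn
  simp at this
  linarith

/-! ### The number of bits of the colours -/

/-- A bound for the number of bits of the colours after a number of Cole–Vishkin steps that start
from colours with `ℓ` bits. -/
def bitBound (ℓ : ℕ) : ℕ → ℕ
  | 0 => ℓ
  | s + 1 => Nat.clog 2 (bitBound ℓ s) + 1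

theorem one_le_bitBound {ℓ : ℕ} (hℓ : 1 ≤ ℓ) : ∀ s, 1 ≤ bitBound ℓ s
  | 0 => hℓ
  | s + 1 => by simp [bitBound]

theorem clog_le_logb_add_one {b : ℕ} (hb : 1 ≤ b) : (Nat.clog 2 b : ℝ) ≤ Real.logb 2 b + 1 := by
  have h0 : (0 : ℝ) < b := by exact_mod_cast hb
  rcases Nat.lt_or_ge 1 b with h1 | h1
  · have h := Nat.pow_pred_clog_lt_self (by norm_num : 1 < 2) h1
    have h2 : ((Nat.clog 2 b).pred : ℝ) ≤ Real.logb 2 b := by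
      rw [Real.le_logb_iff_rpow_le (by norm_num) h0, Real.rpow_natCast]
      exact_mod_cast h.le
    have h3 : Nat.clog 2 b ≤ (Nat.clog 2 b).pred + 1 := by rw [Nat.pred_eq_sub_one]; omega
    have h4 : (Nat.clog 2 b : ℝ) ≤ (Nat.clog 2 b).pred + 1 := by exact_mod_cast h3
    linarith
  · obtain rfl : b = 1 := by omega
    simp

/-- The error 5 reproduces itself: if `b ≤ x + 5` with `x > 1`, then `b ≤ 8x`, and rounding up and
the extra digit cost 2, so the next bound is `log x + 3 + 2`. -/
theorem bitBound_le_iterate {n : ℕ} (hn : 1 ≤ n) (s : ℕ) (hs : s + 1 ≤ logStar n) :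
    (bitBound (bitLog n) s : ℝ) ≤ (Real.logb 2)^[s + 1] n + 5 := by
  induction s with
  | zero =>
    have := bitLog_le_logb_add_one hn
    simp only [bitBound, zero_add, Function.iterate_one]
    linarith
  | succ s ih =>
    have ih := ih (by omega)
    have hx := one_lt_iterate_of_lt_logStar (show s + 1 < logStar n by omega)
    rw [Function.iterate_succ_apply']
    set x := (Real.logb 2)^[s + 1] (n : ℝ)
    have hb := one_le_bitBound (show 1 ≤ bitLog n by simp [bitLog]) s
    have h0 : (0 : ℝ) < bitBound (bitLog n) s := by exact_mod_cast hb
    have h1 := clog_le_logb_add_one hb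
    have h2 : Real.logb 2 (bitBound (bitLog n) s) ≤ Real.logb 2 (2 ^ 3 * x) :=
      Real.logb_le_logb_of_le (by norm_num) h0 (by linarith)
    rw [Real.logb_mul (by norm_num) (by linarith), Real.logb_pow,
      Real.logb_self_eq_one (by norm_num)] at h2
    norm_num at h2
    simp only [bitBound]
    push_cast
    linarith

theorem exists_bitBound_le_six {n : ℕ} (hn : 1 ≤ n) :
    ∃ s ≤ logStar n, bitBound (bitLog n) s ≤ 6 := by
  have hspec := logStar_spec n
  rcases Nat.eq_zero_or_pos (logStar n) with h | h
  · rw [h, Function.iterate_zero_apply] at hspec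
    have : n ≤ 1 := by exact_mod_cast hspec
    obtain rfl : n = 1 := by omega
    exact ⟨0, Nat.zero_le _, by simp [bitBound, bitLog]⟩
  · obtain ⟨s, hs⟩ : ∃ s, logStar n = s + 1 := ⟨logStar n - 1, by omega⟩
    refine ⟨s, by omega, ?_⟩
    have := bitBound_le_iterate hn s hs.ge
    rw [← hs] at this
    have h6 : (bitBound (bitLog n) s : ℝ) ≤ 6 := by linarith
    exact_mod_cast h6

theorem bitBound_succ_le_of_le {ℓ s b c : ℕ} (h : bitBound ℓ s ≤ b) (hbc : b ≤ 2 ^ c) :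
    bitBound ℓ (s + 1) ≤ c + 1 :=
  Nat.succ_le_succ (Nat.clog_le_of_le_pow (h.trans hbc))

/-- From at most six bits, two more steps give 4 and then 3 bits, and three bits are never exceeded
again. -/
theorem bitBound_le_three {n s : ℕ} (hn : 1 ≤ n) (hs : logStar n + 2 ≤ s) :
    bitBound (bitLog n) s ≤ 3 := by
  obtain ⟨r, hr, h⟩ := exists_bitBound_le_six hn
  obtain ⟨d, rfl⟩ : ∃ d, s = r + 2 + d := ⟨s - (r + 2), by omega⟩
  clear hs
  induction d with
  | zero =>
    exact bitBound_succ_le_of_le (bitBound_succ_le_of_le h (c := 3) (by norm_num)) (c := 2)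
      (by norm_num)
  | succ d ih => exact bitBound_succ_le_of_le ih (c := 2) (by norm_num)

/-! ### The Cole–Vishkin step -/

/-- The Cole–Vishkin step: `2 * j + b` where `j` is the first position at which the binary digits
of the two numbers differ, and `b` is the digit of the first number at `j`. -/
noncomputable def cvStep (a p : ℕ) : ℕ :=
  open Classical in
  if h : ∃ j, a.testBit j ≠ p.testBit j then 2 * Nat.find h + (a.testBit (Nat.find h)).toNat else 0

theorem cvStep_self (a : ℕ) : cvStep a a = 0 := by simp [cvStep]

theorem cvStep_eq_of_first {a p j : ℕ} (hj : a.testBit j ≠ p.testBit j)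
    (hlt : ∀ i < j, a.testBit i = p.testBit i) : cvStep a p = 2 * j + (a.testBit j).toNat := by
  classical
  have h : ∃ j, a.testBit j ≠ p.testBit j := ⟨j, hj⟩
  have hf : Nat.find h = j := by
    rw [Nat.find_eq_iff]
    exact ⟨hj, fun i hi hne => hne (hlt i hi)⟩
  rw [cvStep, dif_pos (by exact h)]
  convert rfl using 4 <;> exact hf.symm

theorem exists_first_testBit_ne {a p : ℕ} (h : a ≠ p) :
    ∃ j, a.testBit j ≠ p.testBit j ∧ ∀ i < j, a.testBit i = p.testBit i := by
  classical
  have h : ∃ j, a.testBit j ≠ p.testBit j := by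
    by_contra hc
    push Not at hc
    exact h (Nat.eq_of_testBit_eq hc)
  exact ⟨Nat.find h, Nat.find_spec h, fun i hi => not_not.1 (Nat.find_min h hi)⟩

theorem lt_of_testBit_ne {a p b j : ℕ} (ha : a < 2 ^ b) (hp : p < 2 ^ b)
    (hj : a.testBit j ≠ p.testBit j) : j < b := by
  by_contra h
  have hle : 2 ^ b ≤ 2 ^ j := Nat.pow_le_pow_right (by norm_num) (by omega)
  rw [Nat.testBit_lt_two_pow (by omega), Nat.testBit_lt_two_pow (by omega)] at hj
  exact hj rfl

theorem cvStep_lt {a p b : ℕ} (hb : 1 ≤ b) (ha : a < 2 ^ b) (hp : p < 2 ^ b) :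
    cvStep a p < 2 * b := by
  rcases eq_or_ne a p with rfl | h
  · rw [cvStep_self]; omega
  · obtain ⟨j, hj, hlt⟩ := exists_first_testBit_ne h
    have := lt_of_testBit_ne ha hp hj
    rw [cvStep_eq_of_first hj hlt]
    have := Bool.toNat_lt (a.testBit j)
    omega

/-- Covers a node without a neighbour whose own colour is 0: the default value 0 is again "position
0, digit 0", so it has the same shape as a genuine step. -/
theorem exists_cvStep_eq {a p : ℕ} (h : a = p → a = 0) :
    ∃ j, cvStep a p = 2 * j + (a.testBit j).toNat := by
  rcases eq_or_ne a p with rfl | hne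
  · exact ⟨0, by rw [cvStep_self, h rfl]; simp⟩
  · obtain ⟨j, hj, hlt⟩ := exists_first_testBit_ne hne
    exact ⟨j, cvStep_eq_of_first hj hlt⟩

/-- Equal values encode the same position and the same digit, but `a` and `p` have different digits
at the position chosen for `a`. -/
theorem cvStep_ne {a p q : ℕ} (h : a ≠ p) (hp : p = q → p = 0) : cvStep a p ≠ cvStep p q := by
  obtain ⟨j, hj, hlt⟩ := exists_first_testBit_ne h
  obtain ⟨k, hk⟩ := exists_cvStep_eq hp
  rw [cvStep_eq_of_first hj hlt, hk]
  intro he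
  have h1 := Bool.toNat_lt (a.testBit j)
  have h2 := Bool.toNat_lt (p.testBit k)
  obtain rfl : j = k := by omega
  have h3 : (a.testBit j).toNat = (p.testBit j).toNat := by omega
  exact hj (by revert h3; cases a.testBit j <;> cases p.testBit j <;> simp)

/-! ### Incrementing a binary counter -/

/-- A digit flips exactly when all lower digits are 1. The form is that of the clause of `cnt`. -/
theorem testBit_add_one_iff (t k : ℕ) :
    (t + 1).testBit k = true ↔ ¬ (t.testBit k = true ↔ ∀ j < k, t.testBit j = true) := by
  induction k generalizing t with
  | zero => simp [Nat.testBit_zero]; omega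
  | succ k ih =>
    have hall : (∀ j < k + 1, t.testBit j = true) ↔
        t % 2 = 1 ∧ ∀ j < k, (t / 2).testBit j = true := by
      constructor
      · intro h
        refine ⟨by simpa [Nat.testBit_zero] using h 0 (by omega), fun j hj => ?_⟩
        rw [← Nat.testBit_succ]
        exact h (j + 1) (by omega)
      · rintro ⟨h0, h⟩ (_ | j) hj
        · simpa [Nat.testBit_zero] using h0
        · rw [Nat.testBit_succ]; exact h j (by omega)
    rw [hall, Nat.testBit_succ, Nat.testBit_succ]
    rcases Nat.mod_two_eq_zero_or_one t with h | h
    · rw [show (t + 1) / 2 = t / 2 by omega]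
      simp [h]
    · rw [show (t + 1) / 2 = t / 2 + 1 by omega, ih]
      simp [h]

/-! ### Numerical estimates for colours and counter -/

theorem two_mul_le_two_pow {b : ℕ} (hb : 1 ≤ b) : 2 * b ≤ 2 ^ b := by
  induction b, hb using Nat.le_induction with
  | base => norm_num
  | succ b hb ih => rw [pow_succ]; omega

theorem bitLog_sq_le {b : ℕ} (hb : 1 ≤ b) : bitLog b ^ 2 ≤ 4 * b := by
  have h : ∀ q : ℕ, (q + 1) ^ 2 ≤ 4 * 2 ^ q := fun q => by
    induction q with
    | zero => norm_num
    | succ q ih =>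
      -- The inductive step needs `(q + 2)² ≤ 2(q + 1)²`, which holds only from `q = 2` on.
      rcases Nat.lt_or_ge q 2 with h | h
      · interval_cases q <;> norm_num
      · rw [pow_succ 2 q]; nlinarith
  exact (h _).trans (Nat.mul_le_mul_left 4 (Nat.pow_log_le_self 2 (by omega)))

theorem bitLog_le_self {b : ℕ} (hb : 1 ≤ b) : bitLog b ≤ b :=
  Nat.log_lt_of_lt_pow (by omega) Nat.lt_two_pow_self

/-! ### Neighbours and the colour sequences -/

namespace KripkeModel

variable {ℓ Δ : ℕ} {M : KripkeModel ℓ}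

/-- Among out-neighbours, the number of smaller ones grows strictly with the identifier, and
identifiers are distinct. -/
theorem IsNeighbour.unique (hM : M.InClass Δ) {i : ℕ} {w v v' : M.W}
    (h : M.IsNeighbour i w v) (h' : M.IsNeighbour i w v') : v = v' := by
  have := hM.1
  have key : ∀ v v' : M.W, v ∈ M.succ w → M.ident v < M.ident v' →
      {u | u ∈ M.succ w ∧ M.ident u < M.ident v}.ncard <
        {u | u ∈ M.succ w ∧ M.ident u < M.ident v'}.ncard := fun v v' hv hlt =>
    by
    refine Set.ncard_lt_ncard ⟨fun u hu => ⟨hu.1, hu.2.trans hlt⟩, fun hs => ?_⟩ (Set.toFinite _)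
    exact lt_irrefl (M.ident v) (hs ⟨hv, hlt⟩ : _ ∧ _).2
  by_contra hne
  rcases lt_or_gt_of_ne (fun he => hne (hM.2.1 he) : M.ident v ≠ M.ident v') with hlt | hlt
  · have := key _ _ h.1 hlt
    rw [h.2, h'.2] at this
    exact lt_irrefl _ this
  · have := key _ _ h'.1 hlt
    rw [h.2, h'.2] at this
    exact lt_irrefl _ this

theorem exists_isNeighbour (hM : M.InClass Δ) {w v : M.W} (h : M.R w v) :
    ∃ i < Δ, M.IsNeighbour i w v := by
  have := hM.1
  refine ⟨_, lt_of_lt_of_le (Set.ncard_lt_ncard ?_ (Set.toFinite _)) (hM.2.2 w), h, rfl⟩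
  exact (Set.ssubset_iff_of_subset fun u hu => hu.1).2 ⟨v, h, fun hu => lt_irrefl _ hu.2⟩

open Classical in
/-- The value of `f` at the `(i+1)`-st neighbour, and `0` if there is none. -/
noncomputable def atNeighbour (M : KripkeModel ℓ) (i : ℕ) (f : M.W → ℕ) (w : M.W) : ℕ :=
  if h : ∃ v, M.IsNeighbour i w v then f h.choose else 0

theorem atNeighbour_eq (hM : M.InClass Δ) {i : ℕ} {w v : M.W} (h : M.IsNeighbour i w v)
    (f : M.W → ℕ) : M.atNeighbour i f w = f v := by
  have hex : ∃ v, M.IsNeighbour i w v := ⟨v, h⟩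
  rw [atNeighbour, dif_pos hex, hex.choose_spec.unique hM h]

theorem atNeighbour_eq_zero {i : ℕ} {w : M.W} (h : ¬ ∃ v, M.IsNeighbour i w v)
    (f : M.W → ℕ) : M.atNeighbour i f w = 0 := by
  rw [atNeighbour, dif_neg h]

theorem atNeighbour_lt (i : ℕ) {f : M.W → ℕ} {b : ℕ} (hb : 0 < b) (hf : ∀ v, f v < b)
    (w : M.W) : M.atNeighbour i f w < b := by
  unfold atNeighbour
  split
  exacts [hf _, hb]

/-- A diamond is false at a node without `i`th neighbour, which is why the default colour is 0. -/
theorem exists_isNeighbour_testBit_iff (hM : M.InClass Δ) (i j : ℕ) (f : M.W → ℕ) (w : M.W) :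
    (∃ v, M.IsNeighbour i w v ∧ (f v).testBit j = true) ↔
      (M.atNeighbour i f w).testBit j = true := by
  by_cases h : ∃ v, M.IsNeighbour i w v
  · obtain ⟨v, hv⟩ := h
    rw [atNeighbour_eq hM hv]
    exact ⟨fun ⟨u, hu, hb⟩ => hv.unique hM hu ▸ hb, fun hb => ⟨v, hv, hb⟩⟩
  · rw [atNeighbour_eq_zero h]
    simp only [Nat.zero_testBit, Bool.false_eq_true, iff_false]
    exact fun ⟨v, hv, _⟩ => h ⟨v, hv⟩

open Classical in
/-- The colours with respect to the `(i+1)`-st neighbours after `s` Cole–Vishkin steps. -/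
noncomputable def colour (M : KripkeModel ℓ) (i : ℕ) : ℕ → M.W → ℕ
  | 0, w => Nat.ofBits fun j : Fin ℓ => decide (w ∈ M.V j)
  | s + 1, w => cvStep (colour M i s w) (M.atNeighbour i (colour M i s) w)

theorem testBit_colour_zero (i : ℕ) (w : M.W) (j : Fin ℓ) :
    (M.colour i 0 w).testBit j = true ↔ w ∈ M.V j := by
  simp [colour, Nat.testBit_ofBits_lt]

theorem colour_lt_two_pow_bitBound (hℓ : 1 ≤ ℓ) (i s : ℕ) (w : M.W) :
    M.colour i s w < 2 ^ bitBound ℓ s := by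
  induction s generalizing w with
  | zero => exact Nat.ofBits_lt_two_pow _
  | succ s ih =>
    refine (cvStep_lt (one_le_bitBound hℓ s) (ih w)
      (M.atNeighbour_lt i (by positivity) ih w)).trans_le ?_
    rw [bitBound, pow_succ, mul_comm]
    exact Nat.mul_le_mul_right 2 (Nat.le_pow_clog (by norm_num) _)

/-- Sharper than the bound by a power of two: three bits lead to fewer than 6 colours, whereas 8
would not fit into `Fin 7`. -/
theorem colour_succ_lt (hℓ : 1 ≤ ℓ) (i s : ℕ) (w : M.W) :
    M.colour i (s + 1) w < 2 * bitBound ℓ s :=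
  cvStep_lt (one_le_bitBound hℓ s) (colour_lt_two_pow_bitBound hℓ i s w)
    (M.atNeighbour_lt i (by positivity) (colour_lt_two_pow_bitBound hℓ i s) w)

/-- Guarantees that the `ℓ` digit heads hold every intermediate colour. -/
theorem colour_lt_two_pow (hℓ : 1 ≤ ℓ) (i s : ℕ) (w : M.W) : M.colour i s w < 2 ^ ℓ := by
  induction s generalizing w with
  | zero => exact Nat.ofBits_lt_two_pow _
  | succ s ih =>
    exact (cvStep_lt hℓ (ih w) (M.atNeighbour_lt i (by positivity) ih w)).trans_le
      (two_mul_le_two_pow hℓ)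

theorem colour_ne (hM : M.IsGraph Δ) (s : ℕ) {i : ℕ} {w v : M.W} (h : M.IsNeighbour i w v) :
    M.colour i s w ≠ M.colour i s v := by
  induction s generalizing w v with
  | zero =>
    intro he
    have hwv : w = v := hM.1.2.1 (by
      refine congrArg toLex (funext fun j => ?_)
      have := testBit_colour_zero i w j
      rw [he, testBit_colour_zero] at this
      simp [this])
    exact hM.2.2 w (by simpa [hwv, succ] using h.1)
  | succ s ih =>
    rw [colour, colour, atNeighbour_eq hM.1 h]
    refine cvStep_ne (ih h) fun he => ?_
    by_cases hex : ∃ u, M.IsNeighbour i v u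
    · obtain ⟨u, hu⟩ := hex
      rw [atNeighbour_eq hM.1 hu] at he
      exact absurd he (ih hu)
    · rw [he, atNeighbour_eq_zero hex]

end KripkeModel

end MPMSC

namespace MPMSC

/-! ### Derived connectives -/

namespace Schema

variable {ℓ Δ : ℕ} {X : Type}

/-- Falsity. -/
def bot : Schema ℓ Δ X := neg top

/-- Disjunction. -/
def lor (φ ψ : Schema ℓ Δ X) : Schema ℓ Δ X := neg (and (neg φ) (neg ψ))

/-- Exclusive disjunction. -/
def lxor (φ ψ : Schema ℓ Δ X) : Schema ℓ Δ X := lor (and φ (neg ψ)) (and (neg φ) ψ)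

/-- The schema "if `c` then `φ` else `ψ`". -/
def ifThen (c φ ψ : Schema ℓ Δ X) : Schema ℓ Δ X := lor (and c φ) (and (neg c) ψ)

/-- The conjunction of the schemata `φ 0, …, φ (k - 1)`. -/
def conj : {k : ℕ} → (Fin k → Schema ℓ Δ X) → Schema ℓ Δ X
  | 0, _ => top
  | _ + 1, φ => and (φ 0) (conj fun i => φ i.succ)

/-- The disjunction of the schemata `φ 0, …, φ (k - 1)`. -/
def disj {k : ℕ} (φ : Fin k → Schema ℓ Δ X) : Schema ℓ Δ X := neg (conj fun i => neg (φ i))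

variable (M : KripkeModel ℓ) (g : X → M.W → Prop) (w : M.W) (φ ψ c : Schema ℓ Δ X)

@[simp] theorem sat_top : (top : Schema ℓ Δ X).Sat M g w ↔ True := Iff.rfl
@[simp] theorem sat_var (Y : X) : (var Y : Schema ℓ Δ X).Sat M g w ↔ g Y w := Iff.rfl
@[simp] theorem sat_neg : φ.neg.Sat M g w ↔ ¬ φ.Sat M g w := Iff.rfl
@[simp] theorem sat_and : (φ.and ψ).Sat M g w ↔ φ.Sat M g w ∧ ψ.Sat M g w := Iff.rfl
@[simp] theorem sat_dia (i : Fin Δ) :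
    (dia i φ).Sat M g w ↔ ∃ v, M.IsNeighbour i w v ∧ φ.Sat M g v := Iff.rfl
@[simp] theorem sat_bot : (bot : Schema ℓ Δ X).Sat M g w ↔ False := by simp [bot]
@[simp] theorem sat_lor : (φ.lor ψ).Sat M g w ↔ φ.Sat M g w ∨ ψ.Sat M g w := by
  simp [lor]; tauto
@[simp] theorem sat_lxor : (φ.lxor ψ).Sat M g w ↔ ¬ (φ.Sat M g w ↔ ψ.Sat M g w) := by
  simp [lxor]; tauto
@[simp] theorem sat_ifThen : (ifThen c φ ψ).Sat M g w ↔
    (c.Sat M g w ∧ φ.Sat M g w) ∨ (¬ c.Sat M g w ∧ ψ.Sat M g w) := by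
  simp [ifThen]
@[simp] theorem sat_conj {k : ℕ} (φ : Fin k → Schema ℓ Δ X) :
    (conj φ).Sat M g w ↔ ∀ i, (φ i).Sat M g w := by
  induction k with
  | zero => simp [conj]
  | succ k ih => simp [conj, ih, Fin.forall_fin_succ]
@[simp] theorem sat_disj {k : ℕ} (φ : Fin k → Schema ℓ Δ X) :
    (disj φ).Sat M g w ↔ ∃ i, (φ i).Sat M g w := by
  simp [disj]

theorem modalDepth_conj {k : ℕ} {φ : Fin k → Schema ℓ Δ X} (h : ∀ i, (φ i).modalDepth = 0) :
    (conj φ).modalDepth = 0 := by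
  induction k with
  | zero => rfl
  | succ k ih => simp [conj, modalDepth, h, ih fun i => h i.succ]

theorem modalDepth_disj {k : ℕ} {φ : Fin k → Schema ℓ Δ X} (h : ∀ i, (φ i).modalDepth = 0) :
    (disj φ).modalDepth = 0 := modalDepth_conj (φ := fun i => neg (φ i)) h

theorem length_conj_le {k b : ℕ} {φ : Fin k → Schema ℓ Δ X} (h : ∀ i, (φ i).length ≤ b) :
    (conj φ).length ≤ k * (b + 1) + 1 := by
  induction k with
  | zero => simp [conj, length]
  | succ k ih =>
    have h0 := h 0
    have h1 := ih fun i => h i.succ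
    simp only [conj, length]
    rw [Nat.succ_mul]
    omega

theorem length_disj_le {k b : ℕ} {φ : Fin k → Schema ℓ Δ X} (h : ∀ i, (φ i).length ≤ b) :
    (disj φ).length ≤ k * (b + 2) + 2 :=
  Nat.succ_le_succ (length_conj_le (φ := fun i => neg (φ i)) fun i => Nat.succ_le_succ (h i))

end Schema

namespace Clause

variable {ℓ Δ : ℕ} {X : Type}

@[simp] theorem hotBody_nil (χ : Schema ℓ Δ X) (M : KripkeModel ℓ) (g : X → M.W → Prop)
    (w : M.W) : (Clause.mk [] χ).hotBody M g w = χ := rfl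

theorem hotBody_singleton_of_sat {φ : Schema ℓ Δ X} (ψ χ : Schema ℓ Δ X) {M : KripkeModel ℓ}
    {g : X → M.W → Prop} {w : M.W} (h : φ.Sat M g w) :
    (Clause.mk [(φ, ψ)] χ).hotBody M g w = ψ := by
  simp [hotBody, h]

theorem hotBody_singleton_of_not_sat {φ : Schema ℓ Δ X} (ψ χ : Schema ℓ Δ X) {M : KripkeModel ℓ}
    {g : X → M.W → Prop} {w : M.W} (h : ¬ φ.Sat M g w) :
    (Clause.mk [(φ, ψ)] χ).hotBody M g w = χ := by
  simp [hotBody, h]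

end Clause

/-! ### The Cole–Vishkin program -/

/-- The heads of the Cole–Vishkin program that are not appointed. The program runs in `q + 1`
phases of `ℓ + 2` rounds. -/
inductive CVHead (ℓ Δ m q : ℕ) : Type
  /-- the position in the current phase, in unary -/
  | tok (j : Fin (ℓ + 2))
  /-- the number of phases completed is greater than `b` -/
  | ph (b : Fin (q + 1))
  /-- the index of the digit that is scanned, in binary -/
  | cnt (k : Fin m)
  /-- the digits of the current colours, one colour for each diamond -/
  | col (i : Fin Δ) (j : Fin ℓ)
  /-- the positions at which the colour differs from that of the neighbour -/
  | diff (i : Fin Δ) (j : Fin ℓ)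
  /-- the scan has met a position at which the colours differ -/
  | found (i : Fin Δ)
  /-- the index of the first position at which the colours differ -/
  | idx (i : Fin Δ) (k : Fin m)
  /-- the digit of the colour at this position -/
  | bit (i : Fin Δ)

namespace CVHead

variable {ℓ Δ m q : ℕ}

/-- The non-appointed heads as a sum of standard types. -/
def equivSum : CVHead ℓ Δ m q ≃
    (Fin (ℓ + 2) ⊕ Fin (q + 1) ⊕ Fin m) ⊕
      ((Fin Δ × Fin ℓ) ⊕ (Fin Δ × Fin ℓ)) ⊕ Fin Δ ⊕ (Fin Δ × Fin m) ⊕ Fin Δ where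
  toFun
    | tok j => .inl (.inl j)
    | ph b => .inl (.inr (.inl b))
    | cnt k => .inl (.inr (.inr k))
    | col i j => .inr (.inl (.inl (i, j)))
    | diff i j => .inr (.inl (.inr (i, j)))
    | found i => .inr (.inr (.inl i))
    | idx i k => .inr (.inr (.inr (.inl (i, k))))
    | bit i => .inr (.inr (.inr (.inr i)))
  invFun
    | .inl (.inl j) => tok j
    | .inl (.inr (.inl b)) => ph b
    | .inl (.inr (.inr k)) => cnt k
    | .inr (.inl (.inl (i, j))) => col i j
    | .inr (.inl (.inr (i, j))) => diff i j
    | .inr (.inr (.inl i)) => found i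
    | .inr (.inr (.inr (.inl (i, k)))) => idx i k
    | .inr (.inr (.inr (.inr i))) => bit i
  left_inv := by rintro (_ | _ | _ | _ | _ | _ | _ | _) <;> rfl
  right_inv := by rintro ((_ | _ | _) | (_ | _) | _ | _ | _) <;> rfl

instance : Fintype (CVHead ℓ Δ m q) := Fintype.ofEquiv _ equivSum.symm

theorem sum_eq (f : CVHead ℓ Δ m q → ℕ) : ∑ Y, f Y =
    (∑ j, f (tok j) + (∑ b, f (ph b) + ∑ k, f (cnt k))) +
      ((∑ i, ∑ j, f (col i j) + ∑ i, ∑ j, f (diff i j)) +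
        (∑ i, f (found i) + (∑ i, ∑ k, f (idx i k) + ∑ i, f (bit i)))) := by
  rw [← equivSum.symm.sum_comp]
  simp only [Fintype.sum_sum_type, Fintype.sum_prod_type]
  rfl

end CVHead

/-- The heads of the Cole–Vishkin program; the appointed ones are the tuples of final colours. -/
abbrev CVAll (ℓ Δ m q : ℕ) : Type := CVHead ℓ Δ m q ⊕ (Fin Δ → Fin 7)

namespace CV

open Schema CVHead

variable {ℓ Δ m q : ℕ}

/-- A head that is not appointed as a schema. -/
def v (Y : CVHead ℓ Δ m q) : Schema ℓ Δ (CVAll ℓ Δ m q) := var (.inl Y)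

/-- The program has completed all phases. -/
def done : Schema ℓ Δ (CVAll ℓ Δ m q) := v (ph (Fin.last q))

/-- The terminal clauses. -/
def term : CVAll ℓ Δ m q → Schema ℓ Δ Empty
  | .inl (tok j) => if (j : ℕ) = 0 then top else bot
  | .inl (col _ j) => prop j
  | _ => bot

/-- The digits of the colour that the scan has computed. -/
def newBit (i : Fin Δ) (j : Fin ℓ) : Schema ℓ Δ (CVAll ℓ Δ m q) :=
  match (j : ℕ) with
  | 0 => v (bit i)
  | k + 1 => if h : k < m then v (idx i ⟨k, h⟩) else bot

/-- The final colours are `f`. -/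
def isColour (f : Fin Δ → Fin 7) : Schema ℓ Δ (CVAll ℓ Δ m q) :=
  -- For `ℓ ≤ 2` some values in `Fin 7` do not fit into `ℓ` digits; testing only their low digits
  -- would make several appointed heads true at once.
  if ∀ i, (f i : ℕ) < 2 ^ ℓ then
    conj fun i => conj fun j : Fin ℓ =>
      if (f i : ℕ).testBit j then v (col i j) else neg (v (col i j))
  else bot

/-- The iteration clauses. -/
def iter : CVAll ℓ Δ m q → Clause ℓ Δ (CVAll ℓ Δ m q)
  | .inl (tok ⟨0, _⟩) => ⟨[], v (tok (Fin.last _))⟩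
  | .inl (tok ⟨j + 1, h⟩) => ⟨[], v (tok ⟨j, by omega⟩)⟩
  | .inl (ph ⟨0, h⟩) => ⟨[], lor (v (ph ⟨0, h⟩)) (v (tok (Fin.last _)))⟩
  | .inl (ph ⟨b + 1, h⟩) =>
      ⟨[], lor (v (ph ⟨b + 1, h⟩)) (and (v (tok (Fin.last _))) (v (ph ⟨b, by omega⟩)))⟩
  | .inl (cnt k) =>
      ⟨[], and (neg (v (tok 0))) (lxor (v (cnt k)) (conj fun j : Fin k => v (cnt (j.castLE k.2.le))))⟩
  -- If the scan found no difference, the new colour is 0, in accordance with `cvStep_self`.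
  | .inl (col i j) =>
      ⟨[], ifThen (v (tok (Fin.last _))) (and (v (found i)) (newBit i j)) (v (col i j))⟩
  -- The guard confines the diamond to the first step of an unfinished phase; otherwise the stored
  -- value is copied.
  | .inl (diff i j) =>
      ⟨[(and (v (tok 0)) (neg done), lxor (v (col i j)) (dia i (v (col i j))))], v (diff i j)⟩
  | .inl (found i) =>
      ⟨[], and (neg (v (tok 0)))
        (lor (v (found i)) (disj fun j : Fin ℓ => and (v (tok j.succ.castSucc)) (v (diff i j))))⟩
  | .inl (idx i k) => ⟨[], ifThen (v (found i)) (v (idx i k)) (v (cnt k))⟩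
  | .inl (bit i) =>
      ⟨[], ifThen (v (found i)) (v (bit i))
        (disj fun j : Fin ℓ => and (v (tok j.succ.castSucc)) (v (col i j)))⟩
  | .inr f => ⟨[], and done (isColour f)⟩

theorem depth_newBit (i : Fin Δ) (j : Fin ℓ) :
    (newBit i j : Schema ℓ Δ (CVAll ℓ Δ m q)).modalDepth = 0 := by
  unfold newBit
  split
  · rfl
  · split <;> rfl

theorem depth_isColour (f : Fin Δ → Fin 7) :
    (isColour f : Schema ℓ Δ (CVAll ℓ Δ m q)).modalDepth = 0 := by
  unfold isColour
  split
  · refine modalDepth_conj fun i => modalDepth_conj fun j => ?_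
    split <;> rfl
  · rfl

theorem depth_backup (Y : CVAll ℓ Δ m q) : (iter Y).backup.modalDepth = 0 := by
  rcases Y with (⟨_ | _, _⟩ | ⟨_ | _, _⟩ | _ | _ | _ | _ | _ | _) | _
  case inr => simp [iter, modalDepth, done, v, depth_isColour]
  case inl.cnt k =>
    have := modalDepth_conj
      (φ := fun j : Fin k => (v (cnt (j.castLE k.2.le)) : Schema ℓ Δ (CVAll ℓ Δ m q))) fun _ => rfl
    simp [iter, modalDepth, lor, lxor, this]
    simp [modalDepth, v]
  all_goals
    simp [iter, modalDepth, v, lor, lxor, ifThen, depth_newBit, modalDepth_disj]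

theorem branches_eq_nil_or (Y : CVAll ℓ Δ m q) : (iter Y).branches = [] ∨
    ∃ i j, Y = .inl (diff i j) := by
  rcases Y with (⟨_ | _, _⟩ | ⟨_ | _, _⟩ | _ | _ | _ | _ | _ | _) | _
  case inl.diff => exact .inr ⟨_, _, rfl⟩
  all_goals exact .inl rfl

/-- The Cole–Vishkin program. -/
def program (ℓ Δ m q : ℕ) : Program ℓ Δ (CVAll ℓ Δ m q) where
  nonempty := ⟨.inl (tok 0)⟩
  terminal := term
  iteration := iter
  attention := Finset.univ.map .inr
  print := Finset.univ.map .inr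
  terminal_depth Y := by
    rcases Y with (⟨_ | _, _⟩ | ⟨_ | _, _⟩ | _ | _ | _ | _ | _ | _) | _ <;> rfl
  condition_depth Y b hb := by
    rcases branches_eq_nil_or Y with h | ⟨i, j, rfl⟩
    · simp [h] at hb
    · simp only [iter, List.mem_singleton] at hb
      subst hb
      rfl
  consequence_depth Y b hb := by
    rcases branches_eq_nil_or Y with h | ⟨i, j, rfl⟩
    · simp [h] at hb
    · simp only [iter, List.mem_singleton] at hb
      subst hb
      exact le_rfl
  backup_depth Y := (depth_backup Y).trans_le (Nat.zero_le _)

/-! ### Size -/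

theorem length_newBit_le (i : Fin Δ) (j : Fin ℓ) :
    (newBit i j : Schema ℓ Δ (CVAll ℓ Δ m q)).length ≤ 2 := by
  unfold newBit
  split
  · simp [v, length]
  · split <;> simp [v, bot, length]

/-- A bound for the size of the two clauses of a head. -/
def sizeBound : CVHead ℓ Δ m q → ℕ
  | cnt _ => 19 + 4 * m
  | found _ => 5 * ℓ + 16
  | bit _ => 5 * ℓ + 16
  | _ => 23

theorem size_le_sizeBound (Y : CVHead ℓ Δ m q) :
    (1 + (term (.inl Y) : Schema ℓ Δ Empty).length) + (1 + (iter (.inl Y)).length) ≤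
      sizeBound Y := by
  rcases Y with ⟨_ | _, _⟩ | ⟨_ | _, _⟩ | k | ⟨i, j⟩ | _ | i | _ | i
  case cnt =>
    have := length_conj_le (b := 1)
      (φ := fun j : Fin k => (v (cnt (j.castLE k.2.le)) : Schema ℓ Δ (CVAll ℓ Δ m q)))
      fun _ => le_rfl
    have := k.2
    simp only [term, iter, Clause.length, sizeBound, Schema.length, bot, lor, lxor, List.map_nil,
      List.sum_nil]
    simp only [v, Schema.length] at *
    omega
  case col =>
    have := length_newBit_le (m := m) (q := q) i j
    simp only [term, iter, Clause.length, sizeBound, Schema.length, lor, ifThen, v, List.map_nil,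
      List.sum_nil]
    omega
  case found =>
    have := length_disj_le (b := 3) (φ := fun j : Fin ℓ =>
      (and (v (tok j.succ.castSucc)) (v (diff i j)) : Schema ℓ Δ (CVAll ℓ Δ m q))) fun _ => le_rfl
    simp only [term, iter, Clause.length, sizeBound, Schema.length, bot, lor, v, List.map_nil,
      List.sum_nil] at this ⊢
    omega
  case bit =>
    have := length_disj_le (b := 3) (φ := fun j : Fin ℓ =>
      (and (v (tok j.succ.castSucc)) (v (col i j)) : Schema ℓ Δ (CVAll ℓ Δ m q))) fun _ => le_rfl
    simp only [term, iter, Clause.length, sizeBound, Schema.length, bot, lor, ifThen, v, List.map_nil,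
      List.sum_nil] at this ⊢
    omega
  all_goals
    simp [term, iter, Clause.length, sizeBound, Schema.length, bot, lor, lxor, ifThen, done, v]

theorem sum_sizeBound : ∑ Y : CVHead ℓ Δ m q, sizeBound Y =
    ((ℓ + 2) * 23 + ((q + 1) * 23 + m * (19 + 4 * m))) +
      ((Δ * (ℓ * 23) + Δ * (ℓ * 23)) +
        (Δ * (5 * ℓ + 16) + (Δ * (m * 23) + Δ * (5 * ℓ + 16)))) := by
  simp [sum_eq, sizeBound]

theorem sum_size_le (hℓ : 1 ≤ ℓ) (hΔ : 1 ≤ Δ) (hm : m ≤ ℓ) (hm2 : m ^ 2 ≤ 4 * ℓ)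
    (hq : q ≤ ℓ + 4) :
    ∑ Y : CVHead ℓ Δ m q, ((1 + (term (.inl Y) : Schema ℓ Δ Empty).length) +
      (1 + (iter (.inl Y)).length)) ≤ 500 * (Δ * ℓ) := by
  refine (Finset.sum_le_sum fun Y _ => size_le_sizeBound Y).trans ?_
  rw [sum_sizeBound]
  have h1 : ℓ ≤ Δ * ℓ := Nat.le_mul_of_pos_left _ hΔ
  have h2 : Δ ≤ Δ * ℓ := Nat.le_mul_of_pos_right _ hℓ
  have h3 : Δ * m ≤ Δ * ℓ := Nat.mul_le_mul_left _ hm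
  nlinarith

theorem appointed_program [LinearOrder (CVAll ℓ Δ m q)] :
    (program ℓ Δ m q).appointed = Finset.univ.map .inr := by
  simp [Program.appointed, program]

theorem compl_appointed_program [LinearOrder (CVAll ℓ Δ m q)] :
    (program ℓ Δ m q).appointedᶜ = Finset.univ.map .inl := by
  ext Y
  rw [appointed_program]
  rcases Y with Y | Y <;> simp

theorem card_appointed_program [LinearOrder (CVAll ℓ Δ m q)] :
    (program ℓ Δ m q).appointed.card = 7 ^ Δ := by
  rw [appointed_program]
  simp

theorem size_program [LinearOrder (CVAll ℓ Δ m q)] : (program ℓ Δ m q).size =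
    ∑ Y : CVHead ℓ Δ m q, ((1 + (term (.inl Y) : Schema ℓ Δ Empty).length) +
      (1 + (iter (.inl Y)).length)) := by
  rw [Program.size, compl_appointed_program, Finset.sum_map]
  rfl

theorem numHeads_le_size [LinearOrder (CVAll ℓ Δ m q)] :
    (program ℓ Δ m q).numHeads ≤ (program ℓ Δ m q).size := by
  rw [Program.numHeads, Program.size, Finset.card_eq_sum_ones]
  exact Finset.sum_le_sum fun _ _ => by omega

end CV
end MPMSC

namespace MPMSC
namespace CV

open Schema CVHead

variable {ℓ Δ m q : ℕ}

/-! ### The clock -/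

theorem config_succ (M : KripkeModel ℓ) (t : ℕ) (Y : CVAll ℓ Δ m q) (w : M.W) :
    (program ℓ Δ m q).config M (t + 1) Y w ↔
      ((iter Y).hotBody M ((program ℓ Δ m q).config M t) w).Sat M
        ((program ℓ Δ m q).config M t) w := Iff.rfl

theorem config_tok (M : KripkeModel ℓ) (t : ℕ) (j : Fin (ℓ + 2)) (w : M.W) :
    (program ℓ Δ m q).config M t (.inl (tok j)) w ↔ t % (ℓ + 2) = j := by
  induction t generalizing j with
  | zero =>
    simp only [Program.config, program, term, Nat.zero_mod]
    split <;> rename_i h <;> simp [h]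
    omega
  | succ t ih =>
    have hlt := Nat.mod_lt t (show 0 < ℓ + 2 by omega)
    have hmod : (t + 1) % (ℓ + 2) = if t % (ℓ + 2) = ℓ + 1 then 0 else t % (ℓ + 2) + 1 := by
      rw [Nat.add_mod_eq_ite, Nat.mod_eq_of_lt (show 1 < ℓ + 2 by omega)]
      split <;> split <;> omega
    rw [config_succ, hmod]
    rcases j with ⟨_ | j, hj⟩
    · simp only [iter, Clause.hotBody_nil, v, sat_var, ih, Fin.val_last]
      split <;> simp_all
    · simp only [iter, Clause.hotBody_nil, v, sat_var, ih]
      split <;> omega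

theorem config_ph (M : KripkeModel ℓ) (t : ℕ) (b : Fin (q + 1)) (w : M.W) :
    (program ℓ Δ m q).config M t (.inl (ph b)) w ↔ (b : ℕ) < t / (ℓ + 2) := by
  induction t generalizing b with
  | zero => simp [Program.config, program, term]
  | succ t ih =>
    have hlt := Nat.mod_lt t (show 0 < ℓ + 2 by omega)
    have hdvd : ℓ + 2 ∣ t + 1 ↔ t % (ℓ + 2) = ℓ + 1 := by
      rw [Nat.dvd_iff_mod_eq_zero, Nat.add_mod_eq_ite, Nat.mod_eq_of_lt (show 1 < ℓ + 2 by omega)]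
      split <;> omega
    have hdiv : (t + 1) / (ℓ + 2) = t / (ℓ + 2) + if t % (ℓ + 2) = ℓ + 1 then 1 else 0 := by
      rw [Nat.succ_div]
      simp only [hdvd]
    rw [config_succ, hdiv]
    rcases b with ⟨_ | b, hb⟩
    · simp only [iter, Clause.hotBody_nil, v, sat_lor, sat_var, ih, config_tok, Fin.val_last]
      split <;> simp_all
    · simp only [iter, Clause.hotBody_nil, v, sat_lor, sat_and, sat_var, ih, config_tok,
        Fin.val_last]
      split <;> omega

theorem sat_done (M : KripkeModel ℓ) (t : ℕ) (w : M.W) :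
    (done : Schema ℓ Δ (CVAll ℓ Δ m q)).Sat M ((program ℓ Δ m q).config M t) w ↔
      (q + 1) * (ℓ + 2) ≤ t := by
  simp only [done, v, sat_var, config_ph, Fin.val_last, ← Nat.succ_le_iff]
  exact Nat.le_div_iff_mul_le (by omega)

theorem config_tok_phase (M : KripkeModel ℓ) (s : ℕ) {τ : ℕ} (hτ : τ < ℓ + 2) (j : Fin (ℓ + 2))
    (w : M.W) : (program ℓ Δ m q).config M ((ℓ + 2) * s + τ) (.inl (tok j)) w ↔ τ = j := by
  rw [config_tok, Nat.mul_add_mod, Nat.mod_eq_of_lt hτ]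

/-! ### One phase -/

section Phase

variable {M : KripkeModel ℓ} {s : ℕ}

theorem config_col_phase (i : Fin Δ) (j : Fin ℓ) {τ : ℕ} (hτ : τ < ℓ + 2) (w : M.W) :
    (program ℓ Δ m q).config M ((ℓ + 2) * s + τ) (.inl (col i j)) w ↔
      (program ℓ Δ m q).config M ((ℓ + 2) * s) (.inl (col i j)) w := by
  induction τ with
  | zero => rfl
  | succ τ ih =>
    rw [← ih (by omega), ← add_assoc, config_succ]
    simp only [iter, Clause.hotBody_nil, v, sat_ifThen, sat_and, sat_var,
      config_tok_phase M s (show τ < ℓ + 2 by omega), Fin.val_last]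
    rw [eq_false (show ¬ τ = ℓ + 1 by omega)]
    simp

theorem config_diff_phase (hM : M.InClass Δ) (hs : s ≤ q) {i : Fin Δ} {j : Fin ℓ} {c : M.W → ℕ}
    (hc : ∀ w, (program ℓ Δ m q).config M ((ℓ + 2) * s) (.inl (col i j)) w ↔
      (c w).testBit j = true) {τ : ℕ} (hτ : τ < ℓ + 1) (w : M.W) :
    (program ℓ Δ m q).config M ((ℓ + 2) * s + 1 + τ) (.inl (diff i j)) w ↔
      (c w).testBit j ≠ (M.atNeighbour i c w).testBit j := by
  induction τ with
  | zero =>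
    have h : (and (v (tok 0)) (neg done) : Schema ℓ Δ (CVAll ℓ Δ m q)).Sat M
        ((program ℓ Δ m q).config M ((ℓ + 2) * s)) w := by
      rw [sat_and, sat_neg, sat_done, v, sat_var, config_tok]
      refine ⟨by simp, ?_⟩
      rw [mul_comm, not_le]
      exact Nat.mul_lt_mul_of_pos_left (by omega) (by omega)
    rw [add_zero, config_succ, iter, Clause.hotBody_singleton_of_sat _ _ h]
    simp only [v, sat_lxor, sat_var, sat_dia, hc, KripkeModel.exists_isNeighbour_testBit_iff hM]
    rw [← Bool.eq_iff_iff]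
  | succ τ ih =>
    have h : ¬ (and (v (tok 0)) (neg done) : Schema ℓ Δ (CVAll ℓ Δ m q)).Sat M
        ((program ℓ Δ m q).config M ((ℓ + 2) * s + 1 + τ)) w := by
      rw [sat_and, v, sat_var, add_assoc, config_tok_phase M s (by omega)]
      simp
    rw [← ih (by omega), ← add_assoc, config_succ, iter, Clause.hotBody_singleton_of_not_sat _ _ h]
    rfl

theorem config_cnt_phase (k : Fin m) {τ : ℕ} (hτ : τ < ℓ + 1) (w : M.W) :
    (program ℓ Δ m q).config M ((ℓ + 2) * s + 1 + τ) (.inl (cnt k)) w ↔ τ.testBit k = true := by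
  induction τ generalizing k with
  | zero =>
    rw [add_zero, config_succ]
    simp [iter, v, config_tok]
  | succ τ ih =>
    have ih := fun k => ih k (by omega)
    rw [← add_assoc, config_succ, testBit_add_one_iff]
    simp only [iter, Clause.hotBody_nil, v, sat_and, sat_neg, sat_var, sat_lxor, sat_conj, ih]
    rw [add_assoc, config_tok_phase M s (by omega), Fin.forall_iff]
    simp

/-- The token at `j + 1` marks that position `j` is scanned; its effect is visible one round later,
hence the strict bound. -/
theorem config_found_phase {p : ℕ → Prop} {i : Fin Δ} {w : M.W}
    (hp : ∀ (τ : ℕ) (j : Fin ℓ), τ < ℓ + 1 →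
      ((program ℓ Δ m q).config M ((ℓ + 2) * s + 1 + τ) (.inl (diff i j)) w ↔ p j))
    {τ : ℕ} (hτ : τ < ℓ + 1) :
    (program ℓ Δ m q).config M ((ℓ + 2) * s + 1 + τ) (.inl (found i)) w ↔ ∃ j < τ, p j := by
  induction τ with
  | zero =>
    rw [add_zero, config_succ]
    simp [iter, v, config_tok]
  | succ τ ih =>
    rw [← add_assoc, config_succ]
    simp only [iter, Clause.hotBody_nil, v, sat_and, sat_neg, sat_var, sat_lor, sat_disj,
      ih (by omega), hp τ _ (by omega)]
    simp only [add_assoc, config_tok_phase M s (show 1 + τ < ℓ + 2 by omega)]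
    simp only [Fin.val_zero, Fin.val_castSucc, Fin.val_succ]
    constructor
    · rintro ⟨-, ⟨j, hj, h⟩ | ⟨j, hj, h⟩⟩
      · exact ⟨j, by omega, h⟩
      · exact ⟨j, by omega, h⟩
    · rintro ⟨j, hj, h⟩
      refine ⟨by omega, ?_⟩
      rcases Nat.lt_or_ge j τ with hlt | hge
      · exact .inl ⟨j, hlt, h⟩
      · exact .inr ⟨⟨j, by omega⟩, by simp; omega, h⟩

/-- The head copies the counter until `found` is set. Since `found` lags by one round, the last
value copied is `j` itself, which is then frozen. -/
theorem config_idx_phase {p : ℕ → Prop} {i : Fin Δ} {w : M.W}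
    (hp : ∀ (τ : ℕ) (j : Fin ℓ), τ < ℓ + 1 →
      ((program ℓ Δ m q).config M ((ℓ + 2) * s + 1 + τ) (.inl (diff i j)) w ↔ p j))
    {j : ℕ} (hj : p j) (hlt : ∀ j' < j, ¬ p j') (k : Fin m) {τ : ℕ} (hτ : τ < ℓ + 1)
    (hjτ : j + 1 ≤ τ) :
    (program ℓ Δ m q).config M ((ℓ + 2) * s + 1 + τ) (.inl (idx i k)) w ↔ j.testBit k = true := by
  induction τ, hjτ using Nat.le_induction with
  | base =>
    rw [← add_assoc, config_succ]
    simp only [iter, Clause.hotBody_nil, v, sat_ifThen, sat_var,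
      config_cnt_phase k (show j < ℓ + 1 by omega),
      config_found_phase hp (show j < ℓ + 1 by omega)]
    rw [eq_false (show ¬ ∃ j' < j, p j' from fun ⟨j', h, h'⟩ => hlt j' h h')]
    simp
  | succ τ hle ih =>
    rw [← ih (by omega), ← add_assoc, config_succ]
    simp only [iter, Clause.hotBody_nil, v, sat_ifThen, sat_var,
      config_found_phase hp (show τ < ℓ + 1 by omega)]
    rw [eq_true (show ∃ j' < τ, p j' from ⟨j, hle, hj⟩)]
    simp

theorem config_bit_phase {p : ℕ → Prop} {i : Fin Δ} {w : M.W}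
    (hp : ∀ (τ : ℕ) (j : Fin ℓ), τ < ℓ + 1 →
      ((program ℓ Δ m q).config M ((ℓ + 2) * s + 1 + τ) (.inl (diff i j)) w ↔ p j))
    {a : ℕ} (ha : ∀ j : Fin ℓ, (program ℓ Δ m q).config M ((ℓ + 2) * s) (.inl (col i j)) w ↔
      a.testBit j = true)
    {j : ℕ} (hj : p j) (hlt : ∀ j' < j, ¬ p j') {τ : ℕ} (hτ : τ < ℓ + 1) (hjτ : j + 1 ≤ τ) :
    (program ℓ Δ m q).config M ((ℓ + 2) * s + 1 + τ) (.inl (bit i)) w ↔ a.testBit j = true := by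
  induction τ, hjτ using Nat.le_induction with
  | base =>
    rw [← add_assoc, config_succ]
    simp only [iter, Clause.hotBody_nil, v, sat_ifThen, sat_var, sat_disj, sat_and,
      config_found_phase hp (show j < ℓ + 1 by omega)]
    rw [eq_false (show ¬ ∃ j' < j, p j' from fun ⟨j', h, h'⟩ => hlt j' h h')]
    simp only [add_assoc, config_tok_phase M s (show 1 + j < ℓ + 2 by omega),
      config_col_phase i _ (show 1 + j < ℓ + 2 by omega), ha, Fin.val_castSucc, Fin.val_succ,
      false_and, not_false_eq_true, true_and, false_or]
    constructor
    · rintro ⟨j', h, h'⟩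
      obtain rfl : j = j' := by omega
      exact h'
    · exact fun h => ⟨⟨j, by omega⟩, add_comm _ _, h⟩
  | succ τ hle ih =>
    rw [← ih (by omega), ← add_assoc, config_succ]
    simp only [iter, Clause.hotBody_nil, v, sat_ifThen, sat_var,
      config_found_phase hp (show τ < ℓ + 1 by omega)]
    rw [eq_true (show ∃ j' < τ, p j' from ⟨j, hle, hj⟩)]
    simp

/-- One phase performs one Cole–Vishkin step: in its last round the digit found becomes digit 0 and
the frozen index supplies the higher digits. -/
theorem config_col_succ (hM : M.InClass Δ) (hs : s ≤ q) (hm : ℓ < 2 ^ m) {i : Fin Δ}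
    {c : M.W → ℕ} (hlt : ∀ w, c w < 2 ^ ℓ)
    (hc : ∀ (j : Fin ℓ) (w), (program ℓ Δ m q).config M ((ℓ + 2) * s) (.inl (col i j)) w ↔
      (c w).testBit j = true) (j : Fin ℓ) (w : M.W) :
    (program ℓ Δ m q).config M ((ℓ + 2) * (s + 1)) (.inl (col i j)) w ↔
      (cvStep (c w) (M.atNeighbour i c w)).testBit j = true := by
  have hp : ∀ (τ : ℕ) (j : Fin ℓ), τ < ℓ + 1 →
      ((program ℓ Δ m q).config M ((ℓ + 2) * s + 1 + τ) (.inl (diff i j)) w ↔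
        (c w).testBit j ≠ (M.atNeighbour i c w).testBit j) :=
    fun τ j hτ => config_diff_phase hM hs (hc j) hτ w
  have hfound := config_found_phase (p := fun j => (c w).testBit j ≠
    (M.atNeighbour i c w).testBit j) hp (show ℓ < ℓ + 1 by omega)
  rw [show (ℓ + 2) * (s + 1) = (ℓ + 2) * s + 1 + ℓ + 1 by ring, config_succ]
  simp only [iter, Clause.hotBody_nil, v, sat_ifThen, sat_and, sat_var, hfound]
  have htok := config_tok_phase (Δ := Δ) (m := m) (q := q) M s (show 1 + ℓ < ℓ + 2 by omega)
    (Fin.last _) w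
  rw [← add_assoc] at htok
  rw [eq_true (htok.2 (by simp [add_comm]))]
  simp only [true_and, not_true_eq_false, false_and, or_false]
  rcases eq_or_ne (c w) (M.atNeighbour i c w) with he | hne
  · rw [← he, cvStep_self]
    simp
  · obtain ⟨f, hf, hfirst⟩ := exists_first_testBit_ne hne
    have hfl := lt_of_testBit_ne (hlt w) (M.atNeighbour_lt i (by positivity) hlt w) hf
    have hidx := config_idx_phase (p := fun j => (c w).testBit j ≠
      (M.atNeighbour i c w).testBit j) hp hf (fun j' h h' => h' (hfirst j' h))
    have hbit := config_bit_phase (p := fun j => (c w).testBit j ≠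
      (M.atNeighbour i c w).testBit j) hp (fun j => hc j w) hf (fun j' h h' => h' (hfirst j' h))
      (show ℓ < ℓ + 1 by omega) hfl
    rw [eq_true (⟨f, hfl, hf⟩ : ∃ j < ℓ, (c w).testBit j ≠ (M.atNeighbour i c w).testBit j),
      cvStep_eq_of_first hf hfirst, true_and]
    have hb := Bool.toNat_lt ((c w).testBit f)
    unfold newBit
    split
    · rename_i h0
      rw [v, sat_var, hbit, h0, Nat.testBit_zero]
      cases (c w).testBit f <;> simp
    · rename_i k hk
      rw [hk, Nat.testBit_succ, show (2 * f + ((c w).testBit f).toNat) / 2 = f by omega]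
      split
      · rename_i hkm
        rw [v, sat_var, hidx ⟨k, hkm⟩ (by omega) hfl]
      · rename_i hkm
        -- Digits beyond the counter length are set to 0, correctly, because the position is below
        -- `ℓ < 2 ^ m`.
        have : f < 2 ^ k := (hfl.trans hm).trans_le (Nat.pow_le_pow_right (by norm_num) (by omega))
        simp [Nat.testBit_lt_two_pow this]

end Phase

/-! ### The whole run -/

variable {M : KripkeModel ℓ}

theorem config_col (hM : M.InClass Δ) (hℓ : 1 ≤ ℓ) (hm : ℓ < 2 ^ m) (i : Fin Δ) {s : ℕ}
    (hs : s ≤ q + 1) (j : Fin ℓ) (w : M.W) :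
    (program ℓ Δ m q).config M ((ℓ + 2) * s) (.inl (col i j)) w ↔
      (M.colour i s w).testBit j = true := by
  induction s generalizing j w with
  | zero => rw [KripkeModel.testBit_colour_zero]; rfl
  | succ s ih =>
    exact config_col_succ hM (by omega) hm (KripkeModel.colour_lt_two_pow hℓ i s)
      (fun j w => ih (by omega) j w) j w

theorem not_config_appointed {t : ℕ} (ht : t ≤ (q + 1) * (ℓ + 2)) (f : Fin Δ → Fin 7) (w : M.W) :
    ¬ (program ℓ Δ m q).config M t (.inr f) w := by
  cases t with
  | zero => simp [Program.config, program, term]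
  | succ t =>
    rw [config_succ]
    simp only [iter, Clause.hotBody_nil, sat_and, sat_done]
    omega

theorem config_appointed (hM : M.InClass Δ) (hℓ : 1 ≤ ℓ) (hm : ℓ < 2 ^ m) (f : Fin Δ → Fin 7)
    (w : M.W) : (program ℓ Δ m q).config M ((q + 1) * (ℓ + 2) + 1) (.inr f) w ↔
      ∀ i : Fin Δ, M.colour i (q + 1) w = f i := by
  rw [config_succ]
  simp only [iter, Clause.hotBody_nil, sat_and, sat_done, le_refl, true_and]
  rw [mul_comm]
  have hlt := fun i : Fin Δ => KripkeModel.colour_lt_two_pow hℓ i (q + 1) w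
  unfold isColour
  split
  · rename_i hf
    simp only [sat_conj]
    refine forall_congr' fun i => ?_
    have key : ∀ j : Fin ℓ, (if (f i : ℕ).testBit j then v (col i j) else neg (v (col i j)) :
        Schema ℓ Δ (CVAll ℓ Δ m q)).Sat M ((program ℓ Δ m q).config M ((ℓ + 2) * (q + 1))) w ↔
        (M.colour i (q + 1) w).testBit j = (f i : ℕ).testBit j := by
      intro j
      split <;> rename_i h <;> simp [v, config_col hM hℓ hm i le_rfl j w, h]
    simp only [key]
    constructor
    · intro h
      refine Nat.eq_of_testBit_eq fun j => ?_
      rcases Nat.lt_or_ge j ℓ with hj | hj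
      · exact h ⟨j, hj⟩
      · have hp : 2 ^ ℓ ≤ 2 ^ j := Nat.pow_le_pow_right (by norm_num) hj
        rw [Nat.testBit_lt_two_pow ((hlt i).trans_le hp),
          Nat.testBit_lt_two_pow ((hf i).trans_le hp)]
    · exact fun h j => by rw [h]
  · rename_i hf
    rw [sat_bot, false_iff]
    exact fun h => hf fun i => h i ▸ hlt i

/-- Only the guarded branch of `diff` contains a diamond, and its guard depends on the clock alone,
which is the same at all nodes. -/
theorem commRounds_program (hΔ : 1 ≤ Δ) (hℓ : 1 ≤ ℓ) :
    (program ℓ Δ m q).commRounds M = (fun s => s * (ℓ + 2) + 1) '' Set.Iio (q + 1) := by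
  have hsat : ∀ (t : ℕ) (w : M.W), (and (v (tok 0)) (neg done) : Schema ℓ Δ (CVAll ℓ Δ m q)).Sat M
        ((program ℓ Δ m q).config M t) w ↔ t % (ℓ + 2) = 0 ∧ t < (q + 1) * (ℓ + 2) := by
    intro t w
    rw [sat_and, sat_neg, sat_done, v, sat_var, config_tok, not_le, Fin.val_zero]
  ext n
  simp only [Program.commRounds, Set.mem_ofPred_eq, Set.mem_image, Set.mem_Iio]
  constructor
  · rintro ⟨t, rfl, w, Y, h⟩
    have hback := depth_backup Y
    rcases branches_eq_nil_or Y with hY | ⟨i, j, rfl⟩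
    · have : ((program ℓ Δ m q).iteration Y).hotBody M ((program ℓ Δ m q).config M t) w =
          (iter Y).backup := by
        rw [Clause.hotBody, show ((program ℓ Δ m q).iteration Y).branches = [] from hY]
        rfl
      rw [this] at h
      omega
    · by_cases hs : (and (v (tok 0)) (neg done) : Schema ℓ Δ (CVAll ℓ Δ m q)).Sat M
        ((program ℓ Δ m q).config M t) w
      · obtain ⟨h1, h2⟩ := (hsat t w).1 hs
        refine ⟨t / (ℓ + 2), (Nat.div_lt_iff_lt_mul (by omega)).2 h2, ?_⟩
        rw [Nat.div_mul_cancel (Nat.dvd_of_mod_eq_zero h1)]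
      · exact absurd h (by
          rw [show (program ℓ Δ m q).iteration = iter from rfl, iter,
            Clause.hotBody_singleton_of_not_sat _ _ hs]
          simp [v, modalDepth])
  · rintro ⟨s, hs, rfl⟩
    obtain ⟨w⟩ := M.nonempty
    refine ⟨_, rfl, w, .inl (diff ⟨0, hΔ⟩ ⟨0, hℓ⟩), ?_⟩
    rw [show (program ℓ Δ m q).iteration = iter from rfl, iter,
      Clause.hotBody_singleton_of_sat _ _ ((hsat _ w).2 ⟨by simp, ?_⟩)]
    · simp [lxor, lor, modalDepth]
    · exact Nat.mul_lt_mul_of_pos_right hs (by omega)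

theorem encard_commRounds_program (hΔ : 1 ≤ Δ) (hℓ : 1 ≤ ℓ) :
    ((program ℓ Δ m q).commRounds M).encard = q + 1 := by
  have hinj : Function.Injective fun s => s * (ℓ + 2) + 1 := fun a b h => by
    simpa using h
  rw [commRounds_program hΔ hℓ, hinj.encard_image, ← Finset.coe_Iio,
    Set.encard_coe_eq_coe_finsetCard]
  simp

theorem le_of_mem_commRounds_program (hΔ : 1 ≤ Δ) (hℓ : 1 ≤ ℓ) {r : ℕ}
    (hr : r ∈ (program ℓ Δ m q).commRounds M) : r ≤ (q + 1) * (ℓ + 2) + 1 := by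
  rw [commRounds_program hΔ hℓ] at hr
  obtain ⟨s, hs, rfl⟩ := hr
  exact Nat.succ_le_succ (Nat.mul_le_mul_right _ (le_of_lt hs))

/-! ### The output -/

/-- The appointed heads read `done` from the preceding round, hence the final `+ 1`. -/
theorem acceptsAt_program (hM : M.InClass Δ) (hℓ : 1 ≤ ℓ) (hm : ℓ < 2 ^ m) {w : M.W}
    {f : Fin Δ → Fin 7} (hf : ∀ i : Fin Δ, M.colour i (q + 1) w = f i) :
    (program ℓ Δ m q).AcceptsAt M w ((q + 1) * (ℓ + 2) + 1) := by
  refine ⟨⟨.inr f, by simp [program], (config_appointed hM hℓ hm f w).2 hf⟩, ?_⟩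
  intro t ht Y hY
  obtain ⟨f, -, rfl⟩ := Finset.mem_map.1 hY
  exact not_config_appointed (by omega) f w

end CV

theorem Program.AcceptsAt.unique {ℓ Δ : ℕ} {H : Type} {Λ : Program ℓ Δ H} {M : KripkeModel ℓ}
    {w : M.W} {r t : ℕ} (hr : Λ.AcceptsAt M w r) (ht : Λ.AcceptsAt M w t) : r = t := by
  obtain ⟨Y, hY, h⟩ := hr.1
  obtain ⟨Z, hZ, h'⟩ := ht.1
  rcases lt_trichotomy r t with hlt | rfl | hlt
  · exact absurd h (ht.2 r hlt Y hY)
  · rfl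
  · exact absurd h' (hr.2 t hlt Z hZ)

theorem exists_map_decide_eq {α : Type*} [DecidableEq α] {l : List α} (hl : l.Nodup) {y : α}
    (hy : y ∈ l) : ∃ a b : ℕ, a < l.length ∧ l.map (fun x => decide (x = y)) =
      List.replicate a false ++ true :: List.replicate b false := by
  obtain ⟨l₁, l₂, rfl⟩ := List.append_of_mem hy
  have hd := List.nodup_middle.1 hl
  rw [List.nodup_cons, List.mem_append, not_or] at hd
  refine ⟨l₁.length, l₂.length, by simp, ?_⟩
  rw [List.map_append, List.map_cons, decide_eq_true rfl]
  congr 2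
  · exact List.map_eq_replicate_iff.2 fun x hx => decide_eq_false fun h => hd.1.1 (h ▸ hx)
  · exact List.map_eq_replicate_iff.2 fun x hx => decide_eq_false fun h => hd.1.2 (h ▸ hx)

namespace CV

variable {ℓ Δ m q : ℕ} {M : KripkeModel ℓ}

theorem printString_program [LinearOrder (CVAll ℓ Δ m q)] (hM : M.InClass Δ) (hℓ : 1 ≤ ℓ)
    (hm : ℓ < 2 ^ m) {w : M.W} {f : Fin Δ → Fin 7}
    (hf : ∀ i : Fin Δ, M.colour i (q + 1) w = f i) :
    (program ℓ Δ m q).printString M w ((q + 1) * (ℓ + 2) + 1) =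
      ((program ℓ Δ m q).print.sort (· ≤ ·)).map fun Y => decide (Y = .inr f) := by
  refine List.map_congr_left fun Y hY => ?_
  obtain ⟨g, -, rfl⟩ := Finset.mem_map.1 ((Finset.mem_sort _).1 hY)
  refine decide_eq_decide.2 ?_
  rw [Function.Embedding.inr_apply, config_appointed hM hℓ hm g w]
  simp only [hf, Fin.val_inj, Sum.inr.injEq, funext_iff, eq_comm]

theorem definesProperColouring_program [LinearOrder (CVAll ℓ Δ m q)] (hℓ : 1 ≤ ℓ)
    (hm : ℓ < 2 ^ m) (hq : bitBound ℓ q ≤ 3) :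
    (program ℓ Δ m q).DefinesProperColouring (7 ^ Δ) := by
  have hcol : ∀ (M : KripkeModel ℓ) (w : M.W), ∃ f : Fin Δ → Fin 7,
      ∀ i : Fin Δ, M.colour i (q + 1) w = f i := fun M w =>
    ⟨fun i => ⟨M.colour i (q + 1) w, by
      have := KripkeModel.colour_succ_lt hℓ (i : ℕ) q w
      omega⟩, fun _ => rfl⟩
  have hmem : ∀ f : Fin Δ → Fin 7,
      (.inr f : CVAll ℓ Δ m q) ∈ (program ℓ Δ m q).print.sort (· ≤ ·) := fun f =>
    (Finset.mem_sort _).2 (Finset.mem_map_of_mem _ (Finset.mem_univ f))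
  constructor
  · intro M hM w
    obtain ⟨f, hf⟩ := hcol M w
    refine ⟨_, _, ⟨acceptsAt_program hM.1 hℓ hm hf, rfl⟩, ?_⟩
    rw [printString_program hM.1 hℓ hm hf]
    obtain ⟨a, b, ha, h⟩ := exists_map_decide_eq (Finset.sort_nodup _ _) (hmem f)
    refine ⟨a, b, ?_, h⟩
    rw [Finset.length_sort] at ha
    simpa [program] using ha
  · rintro M hM w u hwu r t _ _ ⟨hr, rfl⟩ ⟨ht, rfl⟩ he
    obtain ⟨f, hf⟩ := hcol M w
    obtain ⟨g, hg⟩ := hcol M u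
    rw [hr.unique (acceptsAt_program hM.1 hℓ hm hf), ht.unique (acceptsAt_program hM.1 hℓ hm hg),
      printString_program hM.1 hℓ hm hf, printString_program hM.1 hℓ hm hg] at he
    have := List.map_inj_left.1 he _ (hmem f)
    have hfg : f = g := by simpa using this
    -- The edge is the `i`th pointer of `w` for some `i`, and equal tuples would agree in this
    -- coordinate.
    obtain ⟨i, hi, hn⟩ := KripkeModel.exists_isNeighbour hM.1 hwu
    exact KripkeModel.colour_ne hM (q + 1) hn ((hf ⟨i, hi⟩).trans (hfg ▸ (hg ⟨i, hi⟩).symm))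

theorem acceptsAt_program_iff (hM : M.InClass Δ) (hℓ : 1 ≤ ℓ) (hm : ℓ < 2 ^ m)
    (hq : bitBound ℓ q ≤ 3) {w : M.W} {r : ℕ} :
    (program ℓ Δ m q).AcceptsAt M w r ↔ r = (q + 1) * (ℓ + 2) + 1 := by
  have h := acceptsAt_program (q := q) hM hℓ hm (w := w)
    (f := fun i => ⟨M.colour i (q + 1) w, by
      have := KripkeModel.colour_succ_lt hℓ (i : ℕ) q w
      omega⟩) fun _ => rfl
  exact ⟨fun hr => hr.unique h, fun hr => hr ▸ h⟩

end CV

end MPMSC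

theorem mainTheorem8 :
    ∃ C : ℕ, ∀ n Δ : ℕ, 1 ≤ n → 1 ≤ Δ →
      ∃ (H : Type) (_ : Fintype H) (_ : LinearOrder H)
        (Λ : MPMSC.Program (MPMSC.bitLog n) Δ H),
        -- the appointed predicates
        (Λ.attention = Λ.print ∧ Λ.appointed.card = 7 ^ Δ) ∧
        -- the colouring
        Λ.DefinesProperColouring (7 ^ Δ) ∧
        -- heads and size, ignoring appointed predicates
        (Λ.numHeads ≤ C * (Δ * MPMSC.bitLog n) ∧ Λ.size ≤ C * (Δ ^ 2 * MPMSC.bitLog n)) ∧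
        -- the number of iterations
        (2 ≤ n → ∀ M : MPMSC.KripkeModel (MPMSC.bitLog n), M.IsGraph Δ →
          ∀ (w : M.W) (r : ℕ), Λ.AcceptsAt M w r →
            r ≤ C * (MPMSC.bitLog n * MPMSC.bitLog (MPMSC.bitLog n) * MPMSC.logStar n)) ∧
        -- the global communication rounds, all of which precede every output
        (∀ M : MPMSC.KripkeModel (MPMSC.bitLog n), M.IsGraph Δ →
          (Λ.commRounds M).encard = MPMSC.logStar n + 4 ∧
          ∀ (w : M.W) (r : ℕ), Λ.AcceptsAt M w r → ∀ s ∈ Λ.commRounds M, s ≤ r) := by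
  refine ⟨500, fun n Δ hn hΔ => ?_⟩
  have hℓ : 1 ≤ MPMSC.bitLog n := Nat.succ_le_succ (Nat.zero_le _)
  have hstar := MPMSC.logStar_le_bitLog hn
  have hq := MPMSC.bitBound_le_three hn (show MPMSC.logStar n + 2 ≤ MPMSC.logStar n + 3 by omega)
  have hm : MPMSC.bitLog n < 2 ^ MPMSC.bitLog (MPMSC.bitLog n) :=
    Nat.lt_pow_succ_log_self (by norm_num) _
  have hm2 := MPMSC.bitLog_sq_le hℓ
  have hml := MPMSC.bitLog_le_self hℓ
  have hm1 : 1 ≤ MPMSC.bitLog (MPMSC.bitLog n) := Nat.succ_le_succ (Nat.zero_le _)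
  have hpos := fun h : 2 ≤ n => MPMSC.one_le_logStar h
  generalize hL : MPMSC.logStar n = L at *
  generalize MPMSC.bitLog n = ℓ at *
  generalize MPMSC.bitLog ℓ = m at *
  -- Any order will do, since exactly one print predicate is true at the output. The parameter `L +
  -- 3` gives `L + 4` phases.
  let ord : LinearOrder (MPMSC.CVAll ℓ Δ m (L + 3)) :=
    LinearOrder.lift' (Fintype.equivFin _) (Equiv.injective _)
  have hsize : (MPMSC.CV.program ℓ Δ m (L + 3)).size ≤ 500 * (Δ * ℓ) := by
    rw [MPMSC.CV.size_program]
    exact MPMSC.CV.sum_size_le hℓ hΔ hml hm2 (by omega)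
  refine ⟨_, inferInstance, ord, MPMSC.CV.program ℓ Δ m (L + 3),
    ⟨rfl, MPMSC.CV.card_appointed_program⟩, MPMSC.CV.definesProperColouring_program hℓ hm hq,
    ⟨MPMSC.CV.numHeads_le_size.trans hsize, hsize.trans ?_⟩, fun h2 M hM w r hr => ?_,
    fun M hM => ⟨?_, fun w r hr s hs => ?_⟩⟩
  · rw [sq, mul_assoc Δ Δ ℓ]
    exact Nat.mul_le_mul_left _ (Nat.le_mul_of_pos_left _ hΔ)
  · rw [(MPMSC.CV.acceptsAt_program_iff hM.1 hℓ hm hq).1 hr]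
    have h1 := hpos h2
    -- Absorbing the additive constants needs `L ≥ 1`, that is, `n ≥ 2`.
    have h3 : (L + 3 + 1) * (ℓ + 2) ≤ (5 * L) * (3 * ℓ) :=
      Nat.mul_le_mul (by omega) (by omega)
    have h4 : ℓ * L ≤ ℓ * m * L := Nat.mul_le_mul_right _ (Nat.le_mul_of_pos_right _ hm1)
    have h5 : 1 ≤ ℓ * L := Nat.mul_pos hℓ h1
    nlinarith
  · rw [MPMSC.CV.encard_commRounds_program hΔ hℓ]
    push_cast
    rw [add_assoc]
    norm_num
  · rw [(MPMSC.CV.acceptsAt_program_iff hM.1 hℓ hm hq).1 hr]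
    exact MPMSC.CV.le_of_mem_commRounds_program hΔ hℓ hs
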